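/- All random variables are finite, logarithms are to base 2, $H$ and $I(\cdot\,;\cdot\,|\,\cdot)$ are Shannon entropy and conditional mutual information, $A-B-C$ means that $A,B,C$ form a Markov chain, and $\Delta$ is total variation distance. For a pair $(X,Y)$ of jointly distributed random variables, the region of tension is $$\mathfrak T(X;Y)=\Big\{s\in\mathbb R_+^3:\ s\ge \big(I(Y;Q|X),\,I(X;Q|Y),\,I(X;Y|Q)\big)\text{ coordinatewise, for some conditional p.m.f. } p_{Q|XY}\Big\},$$ where $Q$ ranges over all finite random variables jointly distributed with $(X,Y)$. For $S\subseteq\mathbb R^3$ and $a\in\mathbb R$, $S+a$ and $S-a$ denote the translates of $S$ by $(a,a,a)$ and $(-a,-a,-a)$. **Theorem.** The region of tension is a robust monotone region. That is, each $\mathfrak T(X;Y)$ is an upward closed subset of $\mathbb R_+^3$, and: 1. (Local computation cannot shrink it.) If $X-Y-Z$, then $\mathfrak T(XY;Z)\supseteq \mathfrak T(Y;Z)$ and $\mathfrak T(X;YZ)\supseteq \mathfrak T(X;Y)$. 2. (Communication cannot shrink it.) For all $(X,Y)$ and all functions $f$ on the alphabet of $X$ and $g$ on the alphabet of $Y$,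 $\mathfrak T(X;Yf(X))\supseteq \mathfrak T(X;Y)$ and $\mathfrak T(Xg(Y);Y)\supseteq \mathfrak T(X;Y)$. 3. (Securely derived outputs.) For all jointly distributed $(X,U,V,Y)$: if $X-U-V$ and $U-V-Y$, then $\mathfrak T(U;V)\supseteq \mathfrak T(XU;YV)$. More generally, there is a constant $c\ge 0$ such that for all $\phi\ge 0$, if $I(X;V|U)\le\phi$ and $I(U;Y|V)\le\phi$, then $\mathfrak T(U;V)\supseteq \mathfrak T(XU;YV)+c\phi$; and the constant $c=1$ has this property. 4. (Continuity, convexity, closure.) There is a bounded continuous function $\hat\delta:[0,1]\to\mathbb R_+$ with $\hat\delta(0)=0$ such that, for all finite alphabets $\mathcal X,\mathcal Y$ and all pairs $(X,Y)$ and $(X',Y')$ over $\mathcal X\times\mathcal Y$, if $\Delta(XY,X'Y')=\epsilon$, then $\mathfrak T(X;Y)\subseteq \mathfrak T(X';Y')-\hat\delta(\epsilon)\log(|\mathcal X||\mathcal Y|)$. Moreover $\mathfrak T(X;Y)$ is convex and closed. 5. (Additivity.) If the pairs $(X_1,Y_1)$ and $(X_2,Y_2)$ are independent of each other, then $\mathfrak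 T(X_1X_2;Y_1Y_2)=\mathfrak T(X_1;Y_1)+\mathfrak T(X_2;Y_2)$ (Minkowski sum). -/

import Mathlib

universe u

/-! Finite probability spaces are pairs of a finite type `Ω` and a probability mass function
`p : stdSimplex ℝ Ω` (nonnegative real weights with total sum `1`).  A random variable with finite
alphabet `α` is a function `X : Ω → α`; its law is `stdSimplex.map X p : stdSimplex ℝ α`. -/

namespace Tension

noncomputable section

/-- Shannon entropy, in bits, of a probability mass function on a finite alphabet:
`H(p) = ∑ₐ p(a) log₂ (1 / p(a))`. -/
def entropy {α : Type*} [Fintype α] (p : stdSimplex ℝ α) : ℝ :=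
  ∑ a, Real.negMulLog (p a) / Real.log 2

/-- Entropy `H(X)` of the random variable `X`. -/
def entropyOf {Ω α : Type*} [Fintype Ω] [Fintype α] (p : stdSimplex ℝ Ω) (X : Ω → α) : ℝ :=
  entropy (stdSimplex.map X p)

/-- Conditional entropy `H(X | Z) = H(X, Z) - H(Z)`. -/
def condEntropy {Ω α γ : Type*} [Fintype Ω] [Fintype α] [Fintype γ]
    (p : stdSimplex ℝ Ω) (X : Ω → α) (Z : Ω → γ) : ℝ :=
  entropyOf p (fun ω => (X ω, Z ω)) - entropyOf p Z

/-- Conditional mutual information `I(X ; Y | Z) = H(X | Z) - H(X | Y, Z)`, in bits. -/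
def condMutualInfo {Ω α β γ : Type*} [Fintype Ω] [Fintype α] [Fintype β] [Fintype γ]
    (p : stdSimplex ℝ Ω) (X : Ω → α) (Y : Ω → β) (Z : Ω → γ) : ℝ :=
  condEntropy p X Z - condEntropy p X (fun ω => (Y ω, Z ω))

/-- `X - Y - Z` is a Markov chain: `p(x,y,z) p(y) = p(x,y) p(y,z)` for all `x, y, z`. -/
def IsMarkovChain {Ω α β γ : Type*} [Fintype Ω] [Fintype α] [Fintype β] [Fintype γ]
    (p : stdSimplex ℝ Ω) (X : Ω → α) (Y : Ω → β) (Z : Ω → γ) : Prop :=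
  ∀ x y z,
    stdSimplex.map (fun ω => (X ω, Y ω, Z ω)) p (x, y, z) * stdSimplex.map Y p y =
      stdSimplex.map (fun ω => (X ω, Y ω)) p (x, y) * stdSimplex.map (fun ω => (Y ω, Z ω)) p (y, z)

/-- `A` and `B` are independent: `p(a,b) = p(a) p(b)` for all `a, b`. -/
def Independent {Ω α β : Type*} [Fintype Ω] [Fintype α] [Fintype β]
    (p : stdSimplex ℝ Ω) (A : Ω → α) (B : Ω → β) : Prop :=
  ∀ a b, stdSimplex.map (fun ω => (A ω, B ω)) p (a, b) =
    stdSimplex.map A p a * stdSimplex.map B p b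

/-- Total variation distance of two probability mass functions on the same finite alphabet. -/
def tvDist {α : Type*} [Fintype α] (p q : stdSimplex ℝ α) : ℝ :=
  (1 / 2) * ∑ a, |p a - q a|

/-- The joint law `p(a) w(q | a)` on `α × κ` of a random variable with law `p` and a random variable
`Q` with alphabet `κ` generated from it by the conditional probability mass function `w`. -/
def extend {α κ : Type*} [Fintype α] [Fintype κ]
    (p : stdSimplex ℝ α) (w : α → stdSimplex ℝ κ) : stdSimplex ℝ (α × κ) :=
  ⟨fun s => p s.1 * w s.1 s.2,
    fun s => mul_nonneg (stdSimplex.zero_le _ _) (stdSimplex.zero_le _ _), by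
      simp [Fintype.sum_prod_type, ← Finset.mul_sum]⟩

/-- The tension `(I(Y;Q|X), I(X;Q|Y), I(X;Y|Q))` of a pair `(X, Y)` with joint law `p`, given the
random variable `Q` with conditional law `w` given `(X, Y)`. -/
def tension {α β κ : Type*} [Fintype α] [Fintype β] [Fintype κ]
    (p : stdSimplex ℝ (α × β)) (w : α × β → stdSimplex ℝ κ) : Fin 3 → ℝ :=
  let r := extend p w
  let X : (α × β) × κ → α := fun s => s.1.1
  let Y : (α × β) × κ → β := fun s => s.1.2
  let Q : (α × β) × κ → κ := fun s => s.2
  ![condMutualInfo r Y Q X, condMutualInfo r X Q Y, condMutualInfo r X Y Q]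

/-- Increasing hull, inside the nonnegative orthant. -/
def increasingHull {d : ℕ} (S : Set (Fin d → ℝ)) : Set (Fin d → ℝ) :=
  {s | 0 ≤ s ∧ ∃ s' ∈ S, s' ≤ s}

/-- A map that assigns a subset of `ℝ^d` to each pair of correlated finite random variables,
given through their joint probability mass function. -/
abbrev PairRegion (d : ℕ) :=
  ∀ ⦃α β : Type u⦄ [Fintype α] [Fintype β], stdSimplex ℝ (α × β) → Set (Fin d → ℝ)

/-- The region of tension: the increasing hull of the tensions of `(X, Y)` given `Q`, where `Q`
ranges over all finite random variables jointly distributed with `(X, Y)`. -/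
def tensionRegion : PairRegion.{u} 3 := fun α β _ _ p =>
  increasingHull {t | ∃ (n : ℕ) (w : α × β → stdSimplex ℝ (Fin n)), t = tension p w}

/-- The value `M(X ; Y)` of a region map on two jointly distributed random variables. -/
def PairRegion.on {d : ℕ} (M : PairRegion.{u} d) {Ω α β : Type u} [Fintype Ω] [Fintype α]
    [Fintype β] (p : stdSimplex ℝ Ω) (X : Ω → α) (Y : Ω → β) : Set (Fin d → ℝ) :=
  M (stdSimplex.map (fun ω => (X ω, Y ω)) p)

/-- Translate of a region by the same real number in each coordinate. -/
def translate {d : ℕ} (S : Set (Fin d → ℝ)) (a : ℝ) : Set (Fin d → ℝ) :=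
  (fun r i => r i + a) '' S

/-- A `d`-dimensional monotone region. -/
structure IsMonotoneRegion {d : ℕ} (M : PairRegion.{u} d) : Prop where
  /-- The values lie in the nonnegative orthant. -/
  nonneg : ∀ {α β : Type u} [Fintype α] [Fintype β] (p : stdSimplex ℝ (α × β)), ∀ r ∈ M p, 0 ≤ r
  /-- The values are upward closed. -/
  upward_closed : ∀ {α β : Type u} [Fintype α] [Fintype β] (p : stdSimplex ℝ (α × β)),
    IsUpperSet (M p)
  /-- Local computation cannot shrink the region. -/
  local_computation : ∀ {Ω α β γ : Type u} [Fintype Ω] [Fintype α] [Fintype β] [Fintype γ]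
    (p : stdSimplex ℝ Ω) (X : Ω → α) (Y : Ω → β) (Z : Ω → γ), IsMarkovChain p X Y Z →
      M.on p Y Z ⊆ M.on p (fun ω => (X ω, Y ω)) Z ∧
      M.on p X Y ⊆ M.on p X (fun ω => (Y ω, Z ω))
  /-- Communication from the holder of `X` cannot shrink the region. -/
  communication_left : ∀ {Ω α β γ : Type u} [Fintype Ω] [Fintype α] [Fintype β] [Fintype γ]
    (p : stdSimplex ℝ Ω) (X : Ω → α) (Y : Ω → β) (f : α → γ),
      M.on p X Y ⊆ M.on p X (fun ω => (Y ω, f (X ω)))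
  /-- Communication from the holder of `Y` cannot shrink the region. -/
  communication_right : ∀ {Ω α β γ : Type u} [Fintype Ω] [Fintype α] [Fintype β] [Fintype γ]
    (p : stdSimplex ℝ Ω) (X : Ω → α) (Y : Ω → β) (f : β → γ),
      M.on p X Y ⊆ M.on p (fun ω => (X ω, f (Y ω))) Y
  /-- Securely derived outputs do not have smaller regions. -/
  secure_derivation : ∀ {Ω α μ ν β : Type u} [Fintype Ω] [Fintype α] [Fintype μ] [Fintype ν]
    [Fintype β] (p : stdSimplex ℝ Ω) (X : Ω → α) (U : Ω → μ) (V : Ω → ν) (Y : Ω → β),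
      IsMarkovChain p X U V → IsMarkovChain p U V Y →
      M.on p (fun ω => (X ω, U ω)) (fun ω => (Y ω, V ω)) ⊆ M.on p U V
  /-- Regions of independent pairs add up (Minkowski sum). -/
  additive : ∀ {Ω α₁ β₁ α₂ β₂ : Type u} [Fintype Ω] [Fintype α₁] [Fintype β₁] [Fintype α₂]
    [Fintype β₂] (p : stdSimplex ℝ Ω) (X₁ : Ω → α₁) (Y₁ : Ω → β₁) (X₂ : Ω → α₂) (Y₂ : Ω → β₂),
      Independent p (fun ω => (X₁ ω, Y₁ ω)) (fun ω => (X₂ ω, Y₂ ω)) →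
      M.on p (fun ω => (X₁ ω, X₂ ω)) (fun ω => (Y₁ ω, Y₂ ω)) =
        {r | ∃ a ∈ M.on p X₁ Y₁, ∃ b ∈ M.on p X₂ Y₂, r = a + b}

/-- Statistically securely derived outputs do not have a much smaller region, with constant `c`:
if `I(X;V|U) ≤ φ` and `I(U;Y|V) ≤ φ` then `M(U;V) ⊇ M(XU;YV) + cφ`. -/
def IsStatSecureRobust {d : ℕ} (M : PairRegion.{u} d) (c : ℝ) : Prop :=
  ∀ {Ω α μ ν β : Type u} [Fintype Ω] [Fintype α] [Fintype μ] [Fintype ν] [Fintype β]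
    (p : stdSimplex ℝ Ω) (X : Ω → α) (U : Ω → μ) (V : Ω → ν) (Y : Ω → β) (φ : ℝ), 0 ≤ φ →
      condMutualInfo p X V U ≤ φ → condMutualInfo p U Y V ≤ φ →
      translate (M.on p (fun ω => (X ω, U ω)) (fun ω => (Y ω, V ω))) (c * φ) ⊆ M.on p U V

/-- A `d`-dimensional robust monotone region. -/
structure IsRobustMonotoneRegion {d : ℕ} (M : PairRegion.{u} d) : Prop
    extends IsMonotoneRegion M where
  stat_secure_derivation : ∃ c : ℝ, 0 ≤ c ∧ IsStatSecureRobust M c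
  /-- Continuity in total variation: one bounded continuous modulus `δ : [0,1] → ℝ₊` with
  `δ(0) = 0` for all alphabets and all pairs of joint laws. -/
  continuity : ∃ δ : unitInterval → NNReal, Continuous δ ∧ BddAbove (Set.range δ) ∧ δ 0 = 0 ∧
    ∀ {α β : Type u} [Fintype α] [Fintype β] (p p' : stdSimplex ℝ (α × β)) (ε : unitInterval),
      tvDist p p' = ε →
      M p ⊆ translate (M p') (-(δ ε * Real.logb 2 (Fintype.card α * Fintype.card β)))
  convex : ∀ {α β : Type u} [Fintype α] [Fintype β] (p : stdSimplex ℝ (α × β)), Convex ℝ (M p)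
  closed : ∀ {α β : Type u} [Fintype α] [Fintype β] (p : stdSimplex ℝ (α × β)), IsClosed (M p)

end

end Tension

namespace Tension

noncomputable section

/-! ### Scalar inequalities for `Real.negMulLog` -/

/-! Everything entropic rests on one scalar fact: `splitEntropy` is concave and homogeneous of
degree one, hence superadditive (`sum_splitEntropy_le`). It makes `condEnt` superadditive, which is
nonnegativity of conditional mutual information, and also subadditive up to one `splitEntropy` term,
which is continuity.

The entropy of a random variable depends only on its kernel, and the kernel of a joint variable is
an infimum. Through `partEntropy`, every information quantity becomes a linear form in entropies of
infima of equivalence relations; once infima are normalised, each comparison of tensions follows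
linearly from a few nonnegative informations. What remains is the choice of Q: unchanged for local
computation and secure derivation, enlarged by the message for communication, (Q₁, Q₂) for a sum of
tensions, and Q together with (Q, X₁, Y₁) for splitting a tension of a product.

For continuity the channel producing Q is kept fixed. The alphabet of Q never enters the bound,
because each coordinate is a difference of conditional entropies of X or of Y.

For convexity and closedness, choosing Q amounts to writing the joint law p as a mixture of
posteriors, and the tension is the same mixture of the values of `pointTension`. So the set of
tensions is the slice over p of the convex hull of a compact graph (`setOf_tension_eq`). It is
convex and compact, and its increasing hull is convex and closed. -/

open Real in
lemma negMulLog_le_tangent {x b : ℝ} (hx : 0 ≤ x) (hb : 0 < b) :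
    negMulLog x ≤ b - x - x * log b := by
  rcases hx.eq_or_lt with rfl | hx
  · simpa using hb.le
  · have h := log_le_sub_one_of_pos (div_pos hb hx)
    rw [log_div hb.ne' hx.ne'] at h
    have h' := mul_le_mul_of_nonneg_left h hx.le
    have e : x * (b / x - 1) = b - x := by field_simp
    rw [negMulLog]
    linarith

/-- The entropy (in nats) of splitting a mass `a + b` into the two parts `a` and `b`. -/
def splitEntropy (a b : ℝ) : ℝ :=
  Real.negMulLog a + Real.negMulLog b - Real.negMulLog (a + b)

@[simp] lemma splitEntropy_zero_left (b : ℝ) : splitEntropy 0 b = 0 := by simp [splitEntropy]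

@[simp] lemma splitEntropy_zero_right (a : ℝ) : splitEntropy a 0 = 0 := by simp [splitEntropy]

open Real in
lemma splitEntropy_nonneg {a b : ℝ} (ha : 0 ≤ a) (hb : 0 ≤ b) : 0 ≤ splitEntropy a b := by
  rcases ha.eq_or_lt with rfl | ha
  · simp
  rcases hb.eq_or_lt with rfl | hb
  · simp
  have h1 := mul_le_mul_of_nonneg_left (log_le_log ha (by linarith : a ≤ a + b)) ha.le
  have h2 := mul_le_mul_of_nonneg_left (log_le_log hb (by linarith : b ≤ a + b)) hb.le
  simp only [splitEntropy, negMulLog]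
  linarith

open Real in
-- Gibbs' inequality: coding the split with a wrong ratio `l` can only cost more. The tangents are
-- taken at `l * (a + b)` and `(1 - l) * (a + b)`.
lemma splitEntropy_le {a b l : ℝ} (ha : 0 ≤ a) (hb : 0 ≤ b) (h0 : 0 < l) (h1 : l < 1) :
    splitEntropy a b ≤ -a * log l - b * log (1 - l) := by
  rcases (add_nonneg ha hb).eq_or_lt with h | h
  · obtain rfl : a = 0 := by linarith
    obtain rfl : b = 0 := by linarith
    simp
  have h1' : 0 < 1 - l := by linarith
  have ea := negMulLog_le_tangent ha (mul_pos h0 h)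
  have eb := negMulLog_le_tangent hb (mul_pos h1' h)
  rw [log_mul h0.ne' h.ne'] at ea
  rw [log_mul h1'.ne' h.ne'] at eb
  simp only [splitEntropy]
  have : negMulLog (a + b) = -(a + b) * log (a + b) := rfl
  nlinarith

open Real in
lemma sum_splitEntropy_le {ι : Type*} (s : Finset ι) {f g : ι → ℝ} (hf : ∀ i, 0 ≤ f i)
    (hg : ∀ i, 0 ≤ g i) :
    ∑ i ∈ s, splitEntropy (f i) (g i) ≤ splitEntropy (∑ i ∈ s, f i) (∑ i ∈ s, g i) := by
  have hF : 0 ≤ ∑ i ∈ s, f i := Finset.sum_nonneg fun i _ => hf i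
  have hG : 0 ≤ ∑ i ∈ s, g i := Finset.sum_nonneg fun i _ => hg i
  rcases hF.eq_or_lt with h | hF
  · have h0 := (Finset.sum_eq_zero_iff_of_nonneg fun i _ => hf i).1 h.symm
    rw [← h, Finset.sum_eq_zero fun i hi => by rw [h0 i hi, splitEntropy_zero_left]]
    simp
  rcases hG.eq_or_lt with h | hG
  · have h0 := (Finset.sum_eq_zero_iff_of_nonneg fun i _ => hg i).1 h.symm
    rw [← h, Finset.sum_eq_zero fun i hi => by rw [h0 i hi, splitEntropy_zero_right]]
    simp
  set F := ∑ i ∈ s, f i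
  set G := ∑ i ∈ s, g i
  have hl : F / (F + G) < 1 := by rw [div_lt_one (by positivity)]; linarith
  have e : 1 - F / (F + G) = G / (F + G) := by field_simp; ring
  -- The total ratio `F / (F + G)` serves as the code for every index; after summation the Gibbs
  -- bound is attained.
  calc ∑ i ∈ s, splitEntropy (f i) (g i)
      ≤ ∑ i ∈ s, (-f i * log (F / (F + G)) - g i * log (1 - F / (F + G))) :=
        Finset.sum_le_sum fun i _ => splitEntropy_le (hf i) (hg i) (by positivity) hl
    _ = -F * log (F / (F + G)) - G * log (1 - F / (F + G)) := by
        simp [F, G, Finset.sum_sub_distrib, Finset.sum_mul]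
    _ = splitEntropy F G := by
        rw [e, log_div hF.ne' (by positivity), log_div hG.ne' (by positivity)]
        simp only [splitEntropy, negMulLog]
        ring

/-! ### Conditional entropy of a nonnegative function on a product -/

/-- Conditional entropy (in nats) of the first coordinate given the second one, for a not
necessarily normalized mass function. -/
def condEnt {α γ : Type*} [Fintype α] [Fintype γ] (m : α × γ → ℝ) : ℝ :=
  ∑ z, (∑ x, Real.negMulLog (m (x, z)) - Real.negMulLog (∑ x, m (x, z)))

section condEnt

variable {α β γ : Type*} [Fintype α] [Fintype β] [Fintype γ]

lemma condEnt_add (m n : α × γ → ℝ) :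
    condEnt (m + n) = condEnt m + condEnt n +
      ∑ z, (splitEntropy (∑ x, m (x, z)) (∑ x, n (x, z)) -
        ∑ x, splitEntropy (m (x, z)) (n (x, z))) := by
  simp only [condEnt, splitEntropy, Pi.add_apply, Finset.sum_add_distrib, Finset.sum_sub_distrib]
  ring

/-- Forgetting which of two components a sample came from can only raise conditional entropy. -/
lemma le_condEnt_add {m n : α × γ → ℝ} (hm : 0 ≤ m) (hn : 0 ≤ n) :
    condEnt m + condEnt n ≤ condEnt (m + n) := by
  rw [condEnt_add, le_add_iff_nonneg_right]
  exact Finset.sum_nonneg fun z _ => sub_nonneg.2 <|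
    sum_splitEntropy_le _ (fun x => hm (x, z)) fun x => hn (x, z)

/-- Revealing the component costs at most the entropy of the component label, whose weights are the
two total masses. -/
lemma condEnt_add_le {m n : α × γ → ℝ} (hm : 0 ≤ m) (hn : 0 ≤ n) :
    condEnt (m + n) ≤ condEnt m + condEnt n + splitEntropy (∑ s, m s) (∑ s, n s) := by
  rw [condEnt_add, add_le_add_iff_left, Fintype.sum_prod_type_right, Fintype.sum_prod_type_right]
  refine le_trans (Finset.sum_le_sum fun z _ => ?_) <| sum_splitEntropy_le _
    (fun z => Finset.sum_nonneg fun x _ => hm (x, z))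
    fun z => Finset.sum_nonneg fun x _ => hn (x, z)
  rw [sub_le_self_iff]
  exact Finset.sum_nonneg fun x _ => splitEntropy_nonneg (hm _) (hn _)

@[simp] lemma condEnt_zero : condEnt (0 : α × γ → ℝ) = 0 := by simp [condEnt]

lemma sum_condEnt_le {ι : Type*} (s : Finset ι) {m : ι → α × γ → ℝ} (hm : ∀ i, 0 ≤ m i) :
    ∑ i ∈ s, condEnt (m i) ≤ condEnt (∑ i ∈ s, m i) := by
  classical
  induction s using Finset.induction_on with
  | empty => simp
  | insert i s hi ih =>
    rw [Finset.sum_insert hi, Finset.sum_insert hi]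
    exact (add_le_add_right ih _).trans
      (le_condEnt_add (hm i) (Finset.sum_nonneg fun j _ => hm j))

lemma condEnt_smul (c : ℝ) (m : α × γ → ℝ) : condEnt (c • m) = c * condEnt m := by
  simp only [condEnt, Pi.smul_apply, smul_eq_mul, Real.negMulLog_mul, ← Finset.mul_sum,
    Finset.sum_add_distrib, ← Finset.sum_mul, Finset.sum_sub_distrib]
  ring

lemma condEnt_nonneg {m : α × γ → ℝ} (hm : 0 ≤ m) : 0 ≤ condEnt m := by
  refine Finset.sum_nonneg fun z _ => sub_nonneg.2 ?_
  have hs : ∀ s : Finset α, Real.negMulLog (∑ x ∈ s, m (x, z)) ≤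
      ∑ x ∈ s, Real.negMulLog (m (x, z)) := by
    classical
    intro s
    induction s using Finset.induction_on with
    | empty => simp
    | insert i s hi ih =>
      rw [Finset.sum_insert hi, Finset.sum_insert hi]
      have := splitEntropy_nonneg (hm (i, z)) (Finset.sum_nonneg fun x (_ : x ∈ s) => hm (x, z))
      simp only [splitEntropy] at this
      linarith
  exact hs _

/-- Each fibre is compared with the uniform distribution, by taking tangents at its mass divided by
`card α`. -/
lemma condEnt_le {m : α × γ → ℝ} (hm : 0 ≤ m) :
    condEnt m ≤ (∑ s, m s) * Real.log (Fintype.card α) := by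
  rw [Fintype.sum_prod_type_right, Finset.sum_mul]
  refine Finset.sum_le_sum fun z _ => ?_
  have hM : 0 ≤ ∑ x, m (x, z) := Finset.sum_nonneg fun x _ => hm (x, z)
  rcases hM.eq_or_lt with h | hM
  · have h0 := (Finset.sum_eq_zero_iff_of_nonneg fun x _ => hm (x, z)).1 h.symm
    rw [← h, Finset.sum_eq_zero fun x hx => by rw [h0 x hx, Real.negMulLog_zero]]
    simp
  have hne : Nonempty α := by
    by_contra hne
    rw [not_nonempty_iff] at hne
    simp at hM
  have hc : (0 : ℝ) < Fintype.card α := by exact_mod_cast Fintype.card_pos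
  set M := ∑ x, m (x, z)
  have hx := Finset.sum_le_sum fun x (_ : x ∈ Finset.univ) =>
    negMulLog_le_tangent (hm (x, z)) (div_pos hM hc)
  simp only [Finset.sum_sub_distrib, ← Finset.sum_mul, Finset.sum_const, Finset.card_univ,
    nsmul_eq_mul] at hx
  rw [Real.log_div hM.ne' hc.ne', mul_div_cancel₀ _ hc.ne'] at hx
  have : Real.negMulLog M = -M * Real.log M := rfl
  linarith

end condEnt

/-! ### Entropies of random variables -/

section law

variable {Ω α β γ κ : Type*} [Fintype Ω] [Fintype α] [Fintype β] [Fintype γ] [Fintype κ]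

open Classical in
lemma map_apply (X : Ω → α) (p : stdSimplex ℝ Ω) (a : α) :
    stdSimplex.map X p a = ∑ ω with X ω = a, p ω := by
  rw [stdSimplex.map_coe, FunOnFinite.linearMap_apply_apply]

lemma map_pos {p : stdSimplex ℝ Ω} {ω : Ω} (h : 0 < p ω) (X : Ω → α) :
    0 < stdSimplex.map X p (X ω) := by
  classical
  rw [map_apply]
  exact h.trans_le (Finset.single_le_sum (f := fun ω => p ω)
    (fun _ _ => stdSimplex.zero_le _ _) (by simp))

lemma map_map (f : Ω → α) (g : α → β) (p : stdSimplex ℝ Ω) :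
    stdSimplex.map g (stdSimplex.map f p) = stdSimplex.map (fun ω => g (f ω)) p :=
  stdSimplex.map_comp_apply f g p

lemma linearMap_eq_sum (X : Ω → α) (Z : Ω → γ) (m : Ω → ℝ) (z : γ) :
    FunOnFinite.linearMap ℝ ℝ Z m z =
      ∑ x, FunOnFinite.linearMap ℝ ℝ (fun ω => (X ω, Z ω)) m (x, z) := by
  classical
  simp only [FunOnFinite.linearMap_apply_apply, Prod.mk.injEq]
  rw [← Finset.sum_fiberwise (Finset.univ.filter fun ω => Z ω = z) X]
  simp only [Finset.filter_filter, and_comm]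

lemma map_eq_sum (X : Ω → α) (Z : Ω → γ) (p : stdSimplex ℝ Ω) (z : γ) :
    stdSimplex.map Z p z = ∑ x, stdSimplex.map (fun ω => (X ω, Z ω)) p (x, z) :=
  linearMap_eq_sum X Z p z

lemma condEntropy_eq_condEnt (p : stdSimplex ℝ Ω) (X : Ω → α) (Z : Ω → γ) :
    condEntropy p X Z = condEnt (stdSimplex.map (fun ω => (X ω, Z ω)) p) / Real.log 2 := by
  simp only [condEntropy, entropyOf, entropy, condEnt, Fintype.sum_prod_type_right,
    map_eq_sum X Z p, ← Finset.sum_div, Finset.sum_sub_distrib, sub_div]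

/-- The entropy, in bits, of the class of a random outcome under an equivalence relation. -/
def partEntropy (p : stdSimplex ℝ Ω) (s : Setoid Ω) : ℝ :=
  open Classical in
  ∑ ω, p ω * (-Real.log (∑ ω' with s ω' ω, p ω') / Real.log 2)

lemma entropyOf_eq_sum (p : stdSimplex ℝ Ω) (X : Ω → α) :
    entropyOf p X = ∑ ω, p ω * (-Real.log (stdSimplex.map X p (X ω)) / Real.log 2) := by
  classical
  rw [← Finset.sum_fiberwise Finset.univ X]
  refine Finset.sum_congr rfl fun a _ => ?_
  rw [Finset.sum_congr rfl fun ω hω => by rw [(Finset.mem_filter.1 hω).2], ← Finset.sum_mul,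
    ← map_apply, Real.negMulLog]
  ring

lemma entropyOf_eq_partEntropy (p : stdSimplex ℝ Ω) (X : Ω → α) :
    entropyOf p X = partEntropy p (Setoid.ker X) := by
  rw [entropyOf_eq_sum, partEntropy]
  simp only [map_apply]
  rfl

lemma ker_prodMk {Ω α β : Type*} (X : Ω → α) (Y : Ω → β) :
    Setoid.ker (fun ω => (X ω, Y ω)) = Setoid.ker X ⊓ Setoid.ker Y := by
  ext a b
  simp [Setoid.ker_def, Setoid.inf_def]

lemma entropyOf_map (p : stdSimplex ℝ Ω) (f : Ω → α) (X : α → β) :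
    entropyOf (stdSimplex.map f p) X = entropyOf p (fun ω => X (f ω)) := by
  rw [entropyOf, map_map, entropyOf]

lemma condEntropy_map (p : stdSimplex ℝ Ω) (f : Ω → κ) (X : κ → α) (Z : κ → γ) :
    condEntropy (stdSimplex.map f p) X Z = condEntropy p (fun ω => X (f ω)) (fun ω => Z (f ω)) := by
  simp only [condEntropy, entropyOf_map]

lemma condMutualInfo_map (p : stdSimplex ℝ Ω) (f : Ω → κ) (X : κ → α) (Y : κ → β) (Z : κ → γ) :
    condMutualInfo (stdSimplex.map f p) X Y Z =
      condMutualInfo p (fun ω => X (f ω)) (fun ω => Y (f ω)) (fun ω => Z (f ω)) := by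
  simp only [condMutualInfo, condEntropy_map]

/-- The joint mass function of X and Z is the sum of its slices over the values of Y, so
superadditivity of `condEnt` says that conditioning reduces entropy. -/
lemma condMutualInfo_nonneg (p : stdSimplex ℝ Ω) (X : Ω → α) (Y : Ω → β) (Z : Ω → γ) :
    0 ≤ condMutualInfo p X Y Z := by
  rw [condMutualInfo, condEntropy_eq_condEnt, condEntropy_eq_condEnt, ← sub_div]
  refine div_nonneg (sub_nonneg.2 ?_) (Real.log_nonneg one_le_two)
  set m : β → α × γ → ℝ := fun y s => stdSimplex.map (fun ω => (X ω, Y ω, Z ω)) p (s.1, y, s.2)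
  have h1 : condEnt (stdSimplex.map (fun ω => (X ω, Y ω, Z ω)) p) = ∑ y, condEnt (m y) := by
    simp only [condEnt, Fintype.sum_prod_type, m]
  have h2 : ⇑(stdSimplex.map (fun ω => (X ω, Z ω)) p) = ∑ y, m y := by
    ext s
    rw [Finset.sum_apply, map_eq_sum Y]
    refine Finset.sum_congr rfl fun y _ => ?_
    simp only [m, map_apply]
    refine Finset.sum_congr ?_ fun _ _ => rfl
    ext
    simp only [Finset.mem_filter, Finset.mem_univ, true_and, Prod.ext_iff]
    tauto
  rw [h1, h2]
  exact sum_condEnt_le _ fun y s => stdSimplex.zero_le _ _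

lemma condMutualInfo_eq_partEntropy (p : stdSimplex ℝ Ω) (X : Ω → α) (Y : Ω → β) (Z : Ω → γ) :
    condMutualInfo p X Y Z = partEntropy p (Setoid.ker X ⊓ Setoid.ker Z) +
      partEntropy p (Setoid.ker Y ⊓ Setoid.ker Z) - partEntropy p (Setoid.ker Z) -
      partEntropy p (Setoid.ker X ⊓ (Setoid.ker Y ⊓ Setoid.ker Z)) := by
  simp only [condMutualInfo, condEntropy, entropyOf_eq_partEntropy, ker_prodMk]
  ring

/-- Submodularity of entropy. -/
lemma partEntropy_submodular (p : stdSimplex ℝ Ω) (s t u : Setoid Ω) :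
    partEntropy p u + partEntropy p (s ⊓ (t ⊓ u)) ≤
      partEntropy p (s ⊓ u) + partEntropy p (t ⊓ u) := by
  classical
  -- Every equivalence relation is the kernel of its quotient map, so inequalities for random
  -- variables transfer to relations.
  have h := condMutualInfo_nonneg p (Quotient.mk'' (s₁ := s)) (Quotient.mk'' (s₁ := t))
    (Quotient.mk'' (s₁ := u))
  simp only [condMutualInfo_eq_partEntropy, Setoid.ker_mk_eq] at h
  linarith

/-- The information is the expectation of a log-ratio that vanishes at every outcome of positive
mass. -/
lemma IsMarkovChain.condMutualInfo_eq_zero {p : stdSimplex ℝ Ω} {X : Ω → α} {Y : Ω → β}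
    {Z : Ω → γ} (h : IsMarkovChain p X Y Z) : condMutualInfo p X Z Y = 0 := by
  have e : condMutualInfo p X Z Y = entropyOf p (fun ω => (X ω, Y ω)) +
      entropyOf p (fun ω => (Y ω, Z ω)) - entropyOf p Y -
      entropyOf p (fun ω => (X ω, Y ω, Z ω)) := by
    simp only [condMutualInfo_eq_partEntropy, entropyOf_eq_partEntropy, ker_prodMk, inf_comm]
  simp only [e, entropyOf_eq_sum, ← Finset.sum_add_distrib, ← Finset.sum_sub_distrib]
  refine Finset.sum_eq_zero fun ω _ => ?_
  rcases (stdSimplex.zero_le p ω).eq_or_lt with h0 | h0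
  · simp [← h0]
  have hl := congrArg Real.log (h (X ω) (Y ω) (Z ω))
  rw [Real.log_mul (map_pos h0 fun ω => (X ω, Y ω, Z ω)).ne' (map_pos h0 Y).ne',
    Real.log_mul (map_pos h0 fun ω => (X ω, Y ω)).ne' (map_pos h0 fun ω => (Y ω, Z ω)).ne'] at hl
  field_simp
  linear_combination p ω * hl

lemma Independent.isMarkovChain {p : stdSimplex ℝ Ω} {A : Ω → α} {B : Ω → β}
    (h : Independent p A B) : IsMarkovChain p A (fun _ => ()) B := by
  classical
  intro a u b
  have h1 := h a b
  have := stdSimplex.sum_eq_one p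
  simp only [map_apply, Prod.mk.injEq] at h1 ⊢
  simpa using h1

end law

/-! ### Tension of a triple of random variables -/

section tensionOf

variable {Ω α β γ κ α₁ β₁ α₂ β₂ κ₁ κ₂ : Type*} [Fintype Ω] [Fintype α] [Fintype β] [Fintype γ]
  [Fintype κ] [Fintype α₁] [Fintype β₁] [Fintype α₂] [Fintype β₂] [Fintype κ₁] [Fintype κ₂]

/-- The tension `(I(Y;Q|X), I(X;Q|Y), I(X;Y|Q))` of three jointly distributed random variables. -/
def tensionOf (p : stdSimplex ℝ Ω) (X : Ω → α) (Y : Ω → β) (Q : Ω → κ) : Fin 3 → ℝ :=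
  ![condMutualInfo p Y Q X, condMutualInfo p X Q Y, condMutualInfo p X Y Q]

lemma tension_eq_tensionOf (p : stdSimplex ℝ (α × β)) (w : α × β → stdSimplex ℝ κ) :
    tension p w = tensionOf (extend p w) (fun s => s.1.1) (fun s => s.1.2) (fun s => s.2) := rfl

lemma tensionOf_map (p : stdSimplex ℝ Ω) (f : Ω → γ) (X : γ → α) (Y : γ → β) (Q : γ → κ) :
    tensionOf (stdSimplex.map f p) X Y Q =
      tensionOf p (fun ω => X (f ω)) (fun ω => Y (f ω)) (fun ω => Q (f ω)) := by
  simp only [tensionOf, condMutualInfo_map]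

lemma tensionOf_nonneg (p : stdSimplex ℝ Ω) (X : Ω → α) (Y : Ω → β) (Q : Ω → κ) :
    0 ≤ tensionOf p X Y Q := by
  intro i
  fin_cases i <;> exact condMutualInfo_nonneg _ _ _ _

lemma tensionOf_le_iff {p : stdSimplex ℝ Ω} {X : Ω → α} {Y : Ω → β} {Q : Ω → κ}
    {s : Fin 3 → ℝ} : tensionOf p X Y Q ≤ s ↔ condMutualInfo p Y Q X ≤ s 0 ∧
      condMutualInfo p X Q Y ≤ s 1 ∧ condMutualInfo p X Y Q ≤ s 2 := by
  simp [Pi.le_def, Fin.forall_fin_succ, tensionOf]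

/-- By the chain rule the hypotheses give I(X;ZQ|Y) = 0. Expanding it in the other order forces
I(X;Q|Y) and I(X;Z|YQ) to vanish, so adjoining X changes nothing. -/
lemma tensionOf_local_left {p : stdSimplex ℝ Ω} {X : Ω → α} {Y : Ω → β} {Z : Ω → γ} {Q : Ω → κ}
    (h : condMutualInfo p X Z Y = 0) (hQ : condMutualInfo p X Q (fun ω => (Y ω, Z ω)) = 0) :
    tensionOf p (fun ω => (X ω, Y ω)) Z Q ≤ tensionOf p Y Z Q := by
  have h1 := condMutualInfo_nonneg p X Z (fun ω => (Y ω, Q ω))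
  have h2 := condMutualInfo_nonneg p X Q Y
  rw [tensionOf_le_iff]
  simp only [tensionOf, Matrix.cons_val, condMutualInfo_eq_partEntropy,
    ker_prodMk, inf_comm, inf_left_comm, inf_assoc] at *
  refine ⟨?_, ?_, ?_⟩ <;> linarith

lemma tensionOf_local_right {p : stdSimplex ℝ Ω} {X : Ω → α} {Y : Ω → β} {Z : Ω → γ} {Q : Ω → κ}
    (h : condMutualInfo p X Z Y = 0) (hQ : condMutualInfo p Z Q (fun ω => (X ω, Y ω)) = 0) :
    tensionOf p X (fun ω => (Y ω, Z ω)) Q ≤ tensionOf p X Y Q := by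
  have h1 := condMutualInfo_nonneg p X Z (fun ω => (Y ω, Q ω))
  have h2 := condMutualInfo_nonneg p Z Q Y
  rw [tensionOf_le_iff]
  simp only [tensionOf, Matrix.cons_val, condMutualInfo_eq_partEntropy,
    ker_prodMk, inf_comm, inf_left_comm, inf_assoc] at *
  refine ⟨?_, ?_, ?_⟩ <;> linarith

lemma tensionOf_communication_left (p : stdSimplex ℝ Ω) (X : Ω → α) (Y : Ω → β) (Q : Ω → κ)
    (f : α → γ) :
    tensionOf p X (fun ω => (Y ω, f (X ω))) (fun ω => (Q ω, f (X ω))) ≤ tensionOf p X Y Q := by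
  -- Exhibiting the kernel of the message as a factor of the kernel of X lets idempotence of infima
  -- absorb the message wherever X occurs.
  obtain ⟨a, ha⟩ : ∃ a, Setoid.ker X = a ⊓ Setoid.ker (fun ω => f (X ω)) :=
    ⟨Setoid.ker X, (inf_eq_left.2 fun _ _ h => congrArg f h).symm⟩
  have h1 := condMutualInfo_nonneg p (fun ω => f (X ω)) Q Y
  have h2 := condMutualInfo_nonneg p (fun ω => f (X ω)) Y Q
  rw [tensionOf_le_iff]
  simp only [tensionOf, Matrix.cons_val, condMutualInfo_eq_partEntropy,
    ker_prodMk, ha, inf_comm, inf_left_comm, inf_assoc, inf_idem] at *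
  refine ⟨?_, ?_, ?_⟩ <;> linarith

lemma tensionOf_communication_right (p : stdSimplex ℝ Ω) (X : Ω → α) (Y : Ω → β) (Q : Ω → κ)
    (f : β → γ) :
    tensionOf p (fun ω => (X ω, f (Y ω))) Y (fun ω => (Q ω, f (Y ω))) ≤ tensionOf p X Y Q := by
  obtain ⟨a, ha⟩ : ∃ a, Setoid.ker Y = a ⊓ Setoid.ker (fun ω => f (Y ω)) :=
    ⟨Setoid.ker Y, (inf_eq_left.2 fun _ _ h => congrArg f h).symm⟩
  have h1 := condMutualInfo_nonneg p (fun ω => f (Y ω)) Q X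
  have h2 := condMutualInfo_nonneg p (fun ω => f (Y ω)) X Q
  rw [tensionOf_le_iff]
  simp only [tensionOf, Matrix.cons_val, condMutualInfo_eq_partEntropy,
    ker_prodMk, ha, inf_comm, inf_left_comm, inf_assoc, inf_idem] at *
  refine ⟨?_, ?_, ?_⟩ <;> linarith

/-- The first coordinate is I(V;Q|U) ≤ I(V;XQ|U) = I(V;X|U) + I(V;Q|XU) ≤ φ + I(YV;Q|XU), and the
second is symmetric. The third is monotonicity of I(·;·|Q) and needs only φ ≥ 0. -/
lemma tensionOf_secure_derivation {p : stdSimplex ℝ Ω} {X : Ω → α} {U : Ω → α₁} {V : Ω → β₁}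
    {Y : Ω → β} {φ : ℝ} (Q : Ω → κ) (hφ : 0 ≤ φ) (hX : condMutualInfo p X V U ≤ φ)
    (hY : condMutualInfo p U Y V ≤ φ) :
    tensionOf p U V Q ≤
      fun i => tensionOf p (fun ω => (X ω, U ω)) (fun ω => (Y ω, V ω)) Q i + φ := by
  have h1 := condMutualInfo_nonneg p X V (fun ω => (U ω, Q ω))
  have h2 := condMutualInfo_nonneg p Y Q (fun ω => (X ω, U ω, V ω))
  have h3 := condMutualInfo_nonneg p Y U (fun ω => (V ω, Q ω))
  have h4 := condMutualInfo_nonneg p X Q (fun ω => (Y ω, U ω, V ω))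
  have h5 := condMutualInfo_nonneg p Y (fun ω => (X ω, U ω)) (fun ω => (V ω, Q ω))
  rw [tensionOf_le_iff]
  simp only [tensionOf, Matrix.cons_val, condMutualInfo_eq_partEntropy,
    ker_prodMk, inf_comm, inf_left_comm, inf_assoc] at *
  refine ⟨?_, ?_, ?_⟩ <;> linarith

@[simp] lemma partEntropy_top (p : stdSimplex ℝ Ω) : partEntropy p ⊤ = 0 := by
  simp [partEntropy, Setoid.top_def]

lemma ker_const {Ω α : Type*} (c : α) : Setoid.ker (fun _ : Ω => c) = ⊤ := by
  ext
  simp [Setoid.ker_def]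

/-- Coarsenings of independent partitions stay independent: submodularity coarsens one side at a
time, and subadditivity gives the reverse bound. -/
lemma partEntropy_inf_of_le {p : stdSimplex ℝ Ω} {s t s' t' : Setoid Ω}
    (h : partEntropy p (s ⊓ t) = partEntropy p s + partEntropy p t) (hs : s ≤ s') (ht : t ≤ t') :
    partEntropy p (s' ⊓ t') = partEntropy p s' + partEntropy p t' := by
  have h1 := partEntropy_submodular p s t s'
  have h2 := partEntropy_submodular p s' t t'
  have h3 := partEntropy_submodular p s' t' ⊤
  have e1 : s ⊓ s' = s := inf_eq_left.2 hs
  have e2 : t ⊓ t' = t := inf_eq_left.2 ht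
  have e3 : s ⊓ (t ⊓ s') = s ⊓ t := by rw [inf_left_comm, e1, inf_comm]
  rw [e3, e1] at h1
  rw [e2] at h2
  simp only [inf_top_eq, partEntropy_top, inf_comm] at *
  linarith

lemma Independent.partEntropy_inf {p : stdSimplex ℝ Ω} {A : Ω → α} {B : Ω → β}
    (h : Independent p A B) : partEntropy p (Setoid.ker A ⊓ Setoid.ker B) =
      partEntropy p (Setoid.ker A) + partEntropy p (Setoid.ker B) := by
  have h := h.isMarkovChain.condMutualInfo_eq_zero
  simp only [condMutualInfo_eq_partEntropy, ker_const, inf_top_eq, partEntropy_top] at h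
  linarith

lemma tensionOf_prod_le {p : stdSimplex ℝ Ω} {X₁ : Ω → α₁} {Y₁ : Ω → β₁} {Q₁ : Ω → κ₁}
    {X₂ : Ω → α₂} {Y₂ : Ω → β₂} {Q₂ : Ω → κ₂}
    (h : Independent p (fun ω => (X₁ ω, Y₁ ω)) (fun ω => (X₂ ω, Y₂ ω)))
    (h₁ : condMutualInfo p (fun ω => (X₂ ω, Y₂ ω)) Q₁ (fun ω => (X₁ ω, Y₁ ω)) = 0)
    (h₂ : condMutualInfo p (fun ω => (X₁ ω, Y₁ ω, Q₁ ω)) Q₂ (fun ω => (X₂ ω, Y₂ ω)) = 0) :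
    tensionOf p (fun ω => (X₁ ω, X₂ ω)) (fun ω => (Y₁ ω, Y₂ ω)) (fun ω => (Q₁ ω, Q₂ ω)) ≤
      tensionOf p X₁ Y₁ Q₁ + tensionOf p X₂ Y₂ Q₂ := by
  have h := h.partEntropy_inf
  rw [tensionOf_le_iff]
  simp only [tensionOf, Matrix.cons_val, condMutualInfo_eq_partEntropy,
    ker_prodMk, Pi.add_apply] at *
  generalize Setoid.ker X₁ = x₁ at *
  generalize Setoid.ker Y₁ = y₁ at *
  generalize Setoid.ker Q₁ = q₁ at *
  generalize Setoid.ker X₂ = x₂ at *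
  generalize Setoid.ker Y₂ = y₂ at *
  generalize Setoid.ker Q₂ = q₂ at *
  -- The two Markov conditions extend independence of the pairs to independence of the triples with
  -- Q₁ and Q₂. All entropies in the tensions then add.
  have hi : partEntropy p ((x₁ ⊓ y₁ ⊓ q₁) ⊓ (x₂ ⊓ y₂ ⊓ q₂)) =
      partEntropy p (x₁ ⊓ y₁ ⊓ q₁) + partEntropy p (x₂ ⊓ y₂ ⊓ q₂) := by
    simp only [inf_comm, inf_left_comm] at *
    linarith
  have k : ∀ s t, x₁ ⊓ y₁ ⊓ q₁ ≤ s → x₂ ⊓ y₂ ⊓ q₂ ≤ t →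
      partEntropy p (s ⊓ t) = partEntropy p s + partEntropy p t :=
    fun s t => partEntropy_inf_of_le hi
  have lx : ∀ x y q : Setoid Ω, x ⊓ y ⊓ q ≤ x := fun _ _ _ => inf_le_left.trans inf_le_left
  have ly : ∀ x y q : Setoid Ω, x ⊓ y ⊓ q ≤ y := fun _ _ _ => inf_le_left.trans inf_le_right
  have lq : ∀ x y q : Setoid Ω, x ⊓ y ⊓ q ≤ q := fun _ _ _ => inf_le_right
  have kx := k _ _ (lx _ _ _) (lx _ _ _)
  have ky := k _ _ (ly _ _ _) (ly _ _ _)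
  have kq := k _ _ (lq _ _ _) (lq _ _ _)
  have kxq := k _ _ (le_inf (lx _ _ _) (lq _ _ _)) (le_inf (lx _ _ _) (lq _ _ _))
  have kyq := k _ _ (le_inf (ly _ _ _) (lq _ _ _)) (le_inf (ly _ _ _) (lq _ _ _))
  simp only [inf_comm, inf_left_comm] at *
  refine ⟨?_, ?_, ?_⟩ <;> linarith

/-- Chain rule, revealing the first pair before the second. Putting X₁ and Y₁ into the second Q
makes its terms match; the leftover cross terms are the nonnegative informations `h1` and `h2`. -/
lemma tensionOf_add_le {p : stdSimplex ℝ Ω} {X₁ : Ω → α₁} {Y₁ : Ω → β₁} {X₂ : Ω → α₂}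
    {Y₂ : Ω → β₂} (Q : Ω → κ)
    (h : Independent p (fun ω => (X₁ ω, Y₁ ω)) (fun ω => (X₂ ω, Y₂ ω))) :
    tensionOf p X₁ Y₁ Q + tensionOf p X₂ Y₂ (fun ω => (Q ω, X₁ ω, Y₁ ω)) ≤
      tensionOf p (fun ω => (X₁ ω, X₂ ω)) (fun ω => (Y₁ ω, Y₂ ω)) Q := by
  have h := h.partEntropy_inf
  have h1 := condMutualInfo_nonneg p Y₁ X₂ (fun ω => (X₁ ω, Q ω))
  have h2 := condMutualInfo_nonneg p X₁ Y₂ (fun ω => (Y₁ ω, Q ω))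
  have kx := partEntropy_inf_of_le (s' := Setoid.ker X₁) (t' := Setoid.ker X₂) h
    (by rw [ker_prodMk]; exact inf_le_left) (by rw [ker_prodMk]; exact inf_le_left)
  have ky := partEntropy_inf_of_le (s' := Setoid.ker Y₁) (t' := Setoid.ker Y₂) h
    (by rw [ker_prodMk]; exact inf_le_right) (by rw [ker_prodMk]; exact inf_le_right)
  have kx2 := partEntropy_inf_of_le (t' := Setoid.ker X₂) h le_rfl
    (by rw [ker_prodMk]; exact inf_le_left)
  have ky2 := partEntropy_inf_of_le (t' := Setoid.ker Y₂) h le_rfl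
    (by rw [ker_prodMk]; exact inf_le_right)
  intro i
  fin_cases i <;>
  · simp only [tensionOf, Matrix.cons_val, condMutualInfo_eq_partEntropy, Fin.isValue, Fin.zero_eta,
      Fin.mk_one, Fin.reduceFinMk, ker_prodMk, Pi.add_apply, inf_comm, inf_left_comm, inf_assoc] at *
    linarith

end tensionOf

/-! ### Membership in the region of tension -/

section region

variable {Ω α β γ κ : Type*} [Fintype Ω] [Fintype α] [Fintype β] [Fintype γ] [Fintype κ]

lemma map_extend (p : stdSimplex ℝ Ω) (f : Ω → α) (w : α → stdSimplex ℝ κ) :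
    stdSimplex.map (fun s : Ω × κ => (f s.1, s.2)) (extend p fun ω => w (f ω)) =
      extend (stdSimplex.map f p) w := by
  classical
  ext ⟨a, q⟩
  have e : ∀ (s : Ω × κ), extend p (fun ω => w (f ω)) s = p s.1 * w (f s.1) s.2 := fun _ => rfl
  have e' : extend (stdSimplex.map f p) w (a, q) = stdSimplex.map f p a * w a q := rfl
  rw [e', map_apply, map_apply, Finset.sum_filter, Fintype.sum_prod_type, Finset.sum_mul,
    Finset.sum_filter]
  refine Finset.sum_congr rfl fun ω _ => ?_
  simp only [e, Prod.mk.injEq]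
  by_cases h : f ω = a <;> simp [h]

lemma map_fst_extend (p : stdSimplex ℝ Ω) (w : Ω → stdSimplex ℝ κ) :
    stdSimplex.map Prod.fst (extend p w) = p := by
  classical
  ext ω
  have e : ∀ (s : Ω × κ), extend p w s = p s.1 * w s.1 s.2 := fun _ => rfl
  rw [map_apply, Finset.sum_filter, Fintype.sum_prod_type]
  simp [e, ← Finset.mul_sum]

/-- Disintegration of a joint law; on outcomes of mass zero the conditional law is an arbitrary
point mass. -/
lemma exists_extend_eq (r : stdSimplex ℝ (Ω × κ)) :
    ∃ w : Ω → stdSimplex ℝ κ, extend (stdSimplex.map Prod.fst r) w = r := by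
  classical
  have hm : ∀ ω, stdSimplex.map Prod.fst r ω = ∑ q, r (ω, q) := by
    intro ω
    rw [map_apply, Finset.sum_filter, Fintype.sum_prod_type_right]
    simp
  have key : ∀ ω, ∃ v : stdSimplex ℝ κ, ∀ q, (∑ q, r (ω, q)) * v q = r (ω, q) := by
    intro ω
    have hs : 0 ≤ ∑ q, r (ω, q) := Finset.sum_nonneg fun q _ => stdSimplex.zero_le _ _
    rcases hs.eq_or_lt with h | h
    · have h0 := (Finset.sum_eq_zero_iff_of_nonneg fun q _ => stdSimplex.zero_le r (ω, q)).1 h.symm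
      have : Nonempty κ := by
        by_contra hne
        rw [not_nonempty_iff] at hne
        simpa using stdSimplex.sum_eq_one r
      refine ⟨stdSimplex.vertex (Classical.arbitrary κ), fun q => ?_⟩
      rw [← h, h0 q (Finset.mem_univ q), zero_mul]
    · refine ⟨⟨fun q => r (ω, q) / ∑ q, r (ω, q),
        fun q => div_nonneg (stdSimplex.zero_le _ _) h.le, ?_⟩, fun q => ?_⟩
      · rw [← Finset.sum_div, div_self h.ne']
      · exact mul_div_cancel₀ _ h.ne'
  choose w hw using key
  refine ⟨w, ?_⟩
  ext ⟨ω, q⟩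
  rw [← hw, ← hm]
  rfl

lemma isMarkovChain_extend (p : stdSimplex ℝ Ω) (A : Ω → β) (f : Ω → α) (w : α → stdSimplex ℝ κ) :
    IsMarkovChain (extend p fun ω => w (f ω)) (fun s => A s.1) (fun s => f s.1) Prod.snd := by
  classical
  intro a y q
  have h1 := congrArg (fun m : stdSimplex ℝ (α × κ) => m (y, q)) (map_extend p f w)
  have h2 := congrArg (fun m : stdSimplex ℝ ((β × α) × κ) => m ((a, y), q))
    (map_extend p (fun ω => (A ω, f ω)) (fun t => w t.2))
  have h3 : stdSimplex.map (fun s : Ω × κ => f s.1) (extend p fun ω => w (f ω)) =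
      stdSimplex.map f p := by rw [← map_map Prod.fst f, map_fst_extend]
  have h4 : stdSimplex.map (fun s : Ω × κ => (A s.1, f s.1)) (extend p fun ω => w (f ω)) =
      stdSimplex.map (fun ω => (A ω, f ω)) p := by
    rw [← map_map Prod.fst (fun ω => (A ω, f ω)), map_fst_extend]
  have h5 : stdSimplex.map (fun s : Ω × κ => (A s.1, f s.1, s.2)) (extend p fun ω => w (f ω))
      (a, y, q) = stdSimplex.map (fun s : Ω × κ => ((A s.1, f s.1), s.2))
        (extend p fun ω => w (f ω)) ((a, y), q) := by
    simp only [map_apply, Prod.mk.injEq, and_assoc]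
  rw [h3, h4, h5]
  simp only at h1 h2
  rw [h1, h2]
  change stdSimplex.map (fun ω => (A ω, f ω)) p (a, y) * w y q * stdSimplex.map f p y =
    stdSimplex.map (fun ω => (A ω, f ω)) p (a, y) * (stdSimplex.map f p y * w y q)
  ring

lemma condMutualInfo_extend (p : stdSimplex ℝ Ω) (A : Ω → β) (f : Ω → α)
    (w : α → stdSimplex ℝ κ) :
    condMutualInfo (extend p fun ω => w (f ω)) (fun s => A s.1) Prod.snd (fun s => f s.1) = 0 :=
  (isMarkovChain_extend p A f w).condMutualInfo_eq_zero

/-- Any Q on any probability space may be used to prove membership in the region: tension depends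
only on the joint law of X, Y and Q, and not on the labels of Q. -/
lemma exists_tension_eq (r : stdSimplex ℝ Ω) (X : Ω → α) (Y : Ω → β) (Q : Ω → κ) :
    ∃ (n : ℕ) (w : α × β → stdSimplex ℝ (Fin n)),
      tensionOf r X Y Q = tension (stdSimplex.map (fun ω => (X ω, Y ω)) r) w := by
  let e := Fintype.equivFin κ
  obtain ⟨w, hw⟩ := exists_extend_eq (stdSimplex.map (fun ω => ((X ω, Y ω), e (Q ω))) r)
  rw [map_map] at hw
  refine ⟨_, w, ?_⟩
  have hk : Setoid.ker (fun ω => e (Q ω)) = Setoid.ker Q := by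
    ext
    simp [Setoid.ker_def]
  rw [tension_eq_tensionOf, hw, tensionOf_map]
  simp only [tensionOf, condMutualInfo_eq_partEntropy, hk]

end region

section regionOn

variable {Ω α β : Type u} [Fintype Ω] [Fintype α] [Fintype β]

lemma mem_tensionRegion_on {κ : Type*} [Fintype κ] {r : stdSimplex ℝ Ω} {X : Ω → α} {Y : Ω → β}
    (Q : Ω → κ) {s : Fin 3 → ℝ} (h : tensionOf r X Y Q ≤ s) :
    s ∈ tensionRegion.{u}.on r X Y := by
  obtain ⟨n, w, hw⟩ := exists_tension_eq r X Y Q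
  exact ⟨(tensionOf_nonneg _ _ _ _).trans h, _, ⟨n, w, rfl⟩, hw ▸ h⟩

lemma exists_of_mem_tensionRegion_on {p : stdSimplex ℝ Ω} {X : Ω → α} {Y : Ω → β} {s : Fin 3 → ℝ}
    (h : s ∈ tensionRegion.{u}.on p X Y) :
    ∃ (n : ℕ) (w : α × β → stdSimplex ℝ (Fin n)),
      tensionOf (extend p fun ω => w (X ω, Y ω)) (fun t => X t.1) (fun t => Y t.1) Prod.snd ≤ s := by
  obtain ⟨-, _, ⟨n, w, rfl⟩, h⟩ := h
  refine ⟨n, w, ?_⟩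
  rwa [tension_eq_tensionOf, ← map_extend, tensionOf_map] at h

lemma PairRegion.on_map {Ω' : Type u} [Fintype Ω'] {d : ℕ} (M : PairRegion.{u} d)
    (p : stdSimplex ℝ Ω') (f : Ω' → Ω) (X : Ω → α) (Y : Ω → β) :
    M.on (stdSimplex.map f p) X Y = M.on p (fun ω => X (f ω)) (fun ω => Y (f ω)) := by
  rw [PairRegion.on, map_map, PairRegion.on]

end regionOn

/-! ### Continuity of conditional entropy in total variation distance -/

section tvDist

variable {Ω α β γ κ : Type*} [Fintype Ω] [Fintype α] [Fintype β] [Fintype γ] [Fintype κ]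

lemma linearMap_nonneg (X : Ω → α) {m : Ω → ℝ} (hm : 0 ≤ m) :
    0 ≤ FunOnFinite.linearMap ℝ ℝ X m := by
  classical
  intro a
  rw [FunOnFinite.linearMap_apply_apply]
  exact Finset.sum_nonneg fun ω _ => hm ω

lemma sum_linearMap (X : Ω → α) (m : Ω → ℝ) :
    ∑ a, FunOnFinite.linearMap ℝ ℝ X m a = ∑ ω, m ω := by
  classical
  simp only [FunOnFinite.linearMap_apply_apply]
  exact Finset.sum_fiberwise Finset.univ X m

lemma tvDist_comm (p q : stdSimplex ℝ Ω) : tvDist p q = tvDist q p := by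
  simp only [tvDist, abs_sub_comm]

lemma tvDist_extend (p q : stdSimplex ℝ Ω) (w : Ω → stdSimplex ℝ κ) :
    tvDist (extend p w) (extend q w) = tvDist p q := by
  have e : ∀ (p : stdSimplex ℝ Ω) (s : Ω × κ), extend p w s = p s.1 * w s.1 s.2 := fun _ _ => rfl
  simp only [tvDist, e, Fintype.sum_prod_type, ← sub_mul, abs_mul,
    abs_of_nonneg (stdSimplex.zero_le (w _) _), ← Finset.mul_sum, stdSimplex.sum_eq_one, mul_one]

/-- With u and v the positive and negative parts of p - q, both of mass ε, p + v = q + u. Hence H(p)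
≤ H(p + v) = H(q + u) ≤ H(q) + H(u) plus the cost of splitting masses 1 and ε, where H(u) ≤ ε log
|α|. -/
lemma condEntropy_le_add_tvDist (p q : stdSimplex ℝ Ω) (X : Ω → α) (Z : Ω → γ) :
    condEntropy p X Z ≤ condEntropy q X Z +
      (tvDist p q * Real.logb 2 (Fintype.card α) + splitEntropy 1 (tvDist p q) / Real.log 2) := by
  set u : Ω → ℝ := fun ω => max (p ω - q ω) 0
  set v : Ω → ℝ := fun ω => max (q ω - p ω) 0
  have hu : 0 ≤ u := fun ω => le_max_right _ _
  have hv : 0 ≤ v := fun ω => le_max_right _ _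
  have hadd : ⇑p + v = ⇑q + u := by
    ext ω
    simp only [u, v, Pi.add_apply]
    rcases le_total (p ω) (q ω) with h | h
    · rw [max_eq_left (by linarith), max_eq_right (by linarith)]; ring
    · rw [max_eq_right (by linarith), max_eq_left (by linarith)]; ring
  have hsum : ∑ ω, u ω = ∑ ω, v ω := by
    have := congrArg (fun m : Ω → ℝ => ∑ ω, m ω) hadd
    simp only [Pi.add_apply, Finset.sum_add_distrib, stdSimplex.sum_eq_one] at this
    linarith
  have htv : ∑ ω, u ω = tvDist p q := by
    have : ∑ ω, |p ω - q ω| = ∑ ω, u ω + ∑ ω, v ω := by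
      rw [← Finset.sum_add_distrib]
      refine Finset.sum_congr rfl fun ω _ => ?_
      simp only [u, v]
      rcases le_total (p ω) (q ω) with h | h
      · rw [max_eq_right (by linarith), max_eq_left (by linarith), abs_of_nonpos (by linarith)]
        ring
      · rw [max_eq_left (by linarith), max_eq_right (by linarith), abs_of_nonneg (by linarith)]
        ring
    rw [tvDist, this]
    linarith
  set P := FunOnFinite.linearMap ℝ ℝ (fun ω => (X ω, Z ω))
  have hp : 0 ≤ P p := linearMap_nonneg _ fun ω => stdSimplex.zero_le p ω
  have hq : 0 ≤ P q := linearMap_nonneg _ fun ω => stdSimplex.zero_le q ω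
  have h1 := le_condEnt_add hp (linearMap_nonneg _ hv : 0 ≤ P v)
  have h2 := condEnt_nonneg (linearMap_nonneg _ hv : 0 ≤ P v)
  have h3 := condEnt_add_le hq (linearMap_nonneg _ hu : 0 ≤ P u)
  have h4 := condEnt_le (linearMap_nonneg _ hu : 0 ≤ P u)
  rw [← map_add, hadd, map_add] at h1
  rw [sum_linearMap, sum_linearMap, stdSimplex.sum_eq_one, htv] at h3
  rw [sum_linearMap, htv] at h4
  have h2pos : 0 < Real.log 2 := Real.log_pos one_lt_two
  rw [condEntropy_eq_condEnt, condEntropy_eq_condEnt, Real.logb, mul_div_assoc', ← add_div,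
    ← add_div]
  refine div_le_div_of_nonneg_right ?_ h2pos.le
  change condEnt (P p) ≤ condEnt (P q) + _
  linarith

lemma condMutualInfo_le_add_tvDist (p q : stdSimplex ℝ Ω) (X : Ω → α) (Y : Ω → β) (Z : Ω → γ) :
    condMutualInfo p X Y Z ≤ condMutualInfo q X Y Z +
      2 * (tvDist p q * Real.logb 2 (Fintype.card α) +
        splitEntropy 1 (tvDist p q) / Real.log 2) := by
  have h1 := condEntropy_le_add_tvDist p q X Z
  have h2 := condEntropy_le_add_tvDist q p X (fun ω => (Y ω, Z ω))
  rw [tvDist_comm] at h2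
  simp only [condMutualInfo]
  linarith

end tvDist

/-- A modulus of continuity for the region of tension. -/
def tensionModulus (ε : ℝ) : ℝ := 2 * (ε + splitEntropy 1 ε / Real.log 2)

lemma continuous_tensionModulus : Continuous tensionModulus := by
  unfold tensionModulus splitEntropy
  fun_prop

lemma tensionModulus_nonneg {ε : ℝ} (hε : 0 ≤ ε) : 0 ≤ tensionModulus ε := by
  have h1 := div_nonneg (splitEntropy_nonneg zero_le_one hε) (Real.log_nonneg one_le_two)
  unfold tensionModulus
  positivity

lemma tension_le_add_tvDist {α β κ : Type*} [Fintype α] [Fintype β] [Fintype κ]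
    (p q : stdSimplex ℝ (α × β)) (w : α × β → stdSimplex ℝ κ) (i : Fin 3) :
    tension p w i ≤ tension q w i + tensionModulus (tvDist p q) *
      Real.logb 2 (Fintype.card α * Fintype.card β) := by
  have hne : Nonempty (α × β) := by
    by_contra hne
    rw [not_nonempty_iff] at hne
    simpa using stdSimplex.sum_eq_one p
  obtain ⟨⟨a₀, b₀⟩⟩ := hne
  have hα : (1 : ℝ) ≤ Fintype.card α := by exact_mod_cast Fintype.card_pos_iff.2 ⟨a₀⟩
  have hβ : (1 : ℝ) ≤ Fintype.card β := by exact_mod_cast Fintype.card_pos_iff.2 ⟨b₀⟩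
  set L := Real.logb 2 (Fintype.card α * Fintype.card β)
  set ε := tvDist p q
  have hε : 0 ≤ ε := mul_nonneg (by norm_num) (Finset.sum_nonneg fun _ _ => abs_nonneg _)
  have hαL : Real.logb 2 (Fintype.card α) ≤ L :=
    Real.logb_le_logb_of_le one_lt_two (by linarith) (by nlinarith)
  have hβL : Real.logb 2 (Fintype.card β) ≤ L :=
    Real.logb_le_logb_of_le one_lt_two (by linarith) (by nlinarith)
  have hsplit : 0 ≤ splitEntropy 1 ε / Real.log 2 :=
    div_nonneg (splitEntropy_nonneg zero_le_one hε) (Real.log_nonneg one_le_two)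
  -- The split term has no alphabet factor. It is absorbed because L ≥ 1 unless there is only one
  -- outcome, in which case ε = 0.
  have hL : splitEntropy 1 ε / Real.log 2 ≤ splitEntropy 1 ε / Real.log 2 * L := by
    rcases subsingleton_or_nontrivial (α × β) with hs | hs
    · have : ε = 0 := by
        rw [show ε = tvDist p q from rfl, Subsingleton.elim q p]
        simp [tvDist]
      simp [this]
    · have h2 : (2 : ℝ) ≤ Fintype.card α * Fintype.card β := by
        have := Fintype.one_lt_card_iff_nontrivial.2 hs
        rw [Fintype.card_prod] at this
        exact_mod_cast this
      have : 1 ≤ L := by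
        rw [← Real.logb_self_eq_one one_lt_two]
        exact Real.logb_le_logb_of_le one_lt_two two_pos h2
      exact le_mul_of_one_le_right hsplit this
  have key : ∀ l, l ≤ L → 2 * (ε * l + splitEntropy 1 ε / Real.log 2) ≤ tensionModulus ε * L := by
    intro l hl
    have := mul_le_mul_of_nonneg_left hl hε
    rw [tensionModulus]
    linarith
  rw [tension_eq_tensionOf, tension_eq_tensionOf]
  set P := extend p w
  set R := extend q w
  have hPR : tvDist P R = ε := tvDist_extend p q w
  fin_cases i
  · have := condMutualInfo_le_add_tvDist P R (fun s => s.1.2) (fun s => s.2) (fun s => s.1.1)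
    rw [hPR] at this
    exact this.trans (add_le_add_right (key _ hβL) _)
  · have := condMutualInfo_le_add_tvDist P R (fun s => s.1.1) (fun s => s.2) (fun s => s.1.2)
    rw [hPR] at this
    exact this.trans (add_le_add_right (key _ hαL) _)
  · have := condMutualInfo_le_add_tvDist P R (fun s => s.1.1) (fun s => s.1.2) (fun s => s.2)
    rw [hPR] at this
    exact this.trans (add_le_add_right (key _ hαL) _)

/-! ### Convexity and compactness of the set of tensions -/

/-- By Carathéodory, the hull is the continuous image of a compact set of weights and `finrank + 1`
points; unused slots get weight 0 and the point `x₀`. -/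
lemma isCompact_convexHull {E : Type*} [NormedAddCommGroup E] [NormedSpace ℝ E]
    [FiniteDimensional ℝ E] {s : Set E} (hs : IsCompact s) : IsCompact (convexHull ℝ s) := by
  classical
  rcases s.eq_empty_or_nonempty with rfl | ⟨x₀, hx₀⟩
  · simp
  set n := Module.finrank ℝ E + 1
  set F : (Fin n → ℝ) × (Fin n → E) → E := fun v => ∑ i, v.1 i • v.2 i
  have hF : Continuous F := by fun_prop
  suffices h : convexHull ℝ s = F '' (stdSimplex ℝ (Fin n) ×ˢ Set.univ.pi fun _ => s) by
    rw [h]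
    exact ((isCompact_stdSimplex ℝ _).prod (isCompact_univ_pi fun _ => hs)).image hF
  refine subset_antisymm (fun x hx => ?_) ?_
  · obtain ⟨ι, _, z, w, hz, hind, hw, hw1, rfl⟩ := eq_pos_convex_span_of_mem_convexHull hx
    have hcard : Fintype.card ι ≤ Fintype.card (Fin n) := by
      rw [Fintype.card_fin]
      exact hind.card_le_finrank_succ.trans (Nat.succ_le_succ (Submodule.finrank_le _))
    obtain ⟨e⟩ := Function.Embedding.nonempty_of_card_le hcard
    refine ⟨(Function.extend e w 0, Function.extend e z fun _ => x₀), ⟨⟨fun i => ?_, ?_⟩,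
      fun i _ => ?_⟩, ?_⟩
    · by_cases hi : ∃ j, e j = i
      · obtain ⟨j, rfl⟩ := hi
        simpa [e.injective.extend_apply] using (hw j).le
      · simp [Function.extend_apply' _ _ _ hi]
    · rw [← hw1]
      refine (Fintype.sum_of_injective e e.injective _ _ (fun i hi => ?_) fun j => ?_).symm
      · exact Function.extend_apply' _ _ _ hi
      · exact (e.injective.extend_apply _ _ _).symm
    · by_cases hi : ∃ j, e j = i
      · obtain ⟨j, rfl⟩ := hi
        simpa [e.injective.extend_apply] using hz ⟨j, rfl⟩
      · simpa [Function.extend_apply' _ _ _ hi] using hx₀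
    · refine (Fintype.sum_of_injective e e.injective _ _ (fun i hi => ?_) fun j => ?_).symm
      · simp only [Function.extend_apply' _ _ _ hi, Pi.zero_apply, zero_smul]
      · simp only [e.injective.extend_apply]
  · rintro _ ⟨⟨w, z⟩, ⟨hw, hz⟩, rfl⟩
    exact mem_convexHull_of_exists_fintype w z hw.1 hw.2 (fun i => hz i trivial) rfl

/-! ### Tensions as mixtures over the values of Q -/

section mixture

variable {Ω α β γ κ : Type*} [Fintype Ω] [Fintype α] [Fintype β] [Fintype γ] [Fintype κ]

lemma map_snd_extend_apply (l : stdSimplex ℝ κ) (a : κ → stdSimplex ℝ Ω) (ω : Ω) :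
    stdSimplex.map Prod.snd (extend l a) ω = ∑ q, l q * a q ω := by
  classical
  have e : ∀ s : κ × Ω, extend l a s = l s.1 * a s.1 s.2 := fun _ => rfl
  rw [map_apply, Finset.sum_filter, Fintype.sum_prod_type]
  simp [e]

lemma condEntropy_mixture (l : stdSimplex ℝ κ) (a : κ → stdSimplex ℝ Ω) (X : Ω → α) (Z : Ω → γ) :
    condEntropy (extend l a) (fun s => X s.2) (fun s => (s.1, Z s.2)) =
      ∑ q, l q * condEntropy (a q) X Z := by
  classical
  have e : ∀ s : κ × Ω, extend l a s = l s.1 * a s.1 s.2 := fun _ => rfl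
  have h : ∀ q x z, stdSimplex.map (fun s : κ × Ω => (X s.2, s.1, Z s.2)) (extend l a) (x, q, z) =
      l q * stdSimplex.map (fun ω => (X ω, Z ω)) (a q) (x, z) := by
    intro q x z
    rw [map_apply, map_apply, Finset.sum_filter, Fintype.sum_prod_type, Finset.mul_sum,
      Finset.sum_filter, Finset.sum_eq_single q (fun q' _ hq => by simp [hq]) (by simp)]
    simp [e]
  simp only [condEntropy_eq_condEnt, mul_div_assoc', ← Finset.sum_div, ← condEnt_smul]
  congr 1
  simp only [condEnt, Fintype.sum_prod_type, h, Pi.smul_apply, smul_eq_mul]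

/-- The terms whose average over the values of `Q` is the tension. -/
def pointTension (p : stdSimplex ℝ (α × β)) (a : stdSimplex ℝ (α × β)) : Fin 3 → ℝ :=
  ![condEntropy p Prod.snd Prod.fst - condEntropy a Prod.snd Prod.fst,
    condEntropy p Prod.fst Prod.snd - condEntropy a Prod.fst Prod.snd,
    condEntropy a Prod.fst (fun _ => ()) - condEntropy a Prod.fst Prod.snd]

lemma tensionOf_mixture (l : stdSimplex ℝ κ) (a : κ → stdSimplex ℝ (α × β)) :
    tensionOf (extend l a) (fun s => s.2.1) (fun s => s.2.2) Prod.fst =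
      ∑ q, l q • pointTension (stdSimplex.map Prod.snd (extend l a)) (a q) := by
  have h1 := condEntropy_mixture l a Prod.snd Prod.fst
  have h2 := condEntropy_mixture l a Prod.fst Prod.snd
  have h3 := condEntropy_mixture l a Prod.fst (fun _ => ())
  have e1 : condEntropy (extend l a) (fun s => s.2.1) (fun s => (s.2.2, s.1)) =
      condEntropy (extend l a) (fun s => s.2.1) (fun s => (s.1, s.2.2)) := by
    simp only [condEntropy, entropyOf_eq_partEntropy, ker_prodMk, inf_comm]
  have e2 : condEntropy (extend l a) (fun s => s.2.1) (fun s => (s.1, ())) =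
      condEntropy (extend l a) (fun s => s.2.1) Prod.fst := by
    simp only [condEntropy, entropyOf_eq_partEntropy, ker_prodMk, ker_const, inf_top_eq]
  have hm1 := condEntropy_map (extend l a) Prod.snd Prod.snd Prod.fst
  have hm2 := condEntropy_map (extend l a) Prod.snd Prod.fst Prod.snd
  have hl := stdSimplex.sum_eq_one l
  ext i
  fin_cases i <;>
  simp [tensionOf, pointTension, condMutualInfo, e1, h1, h2, h3, ← e2, hm1, hm2, mul_sub,
    Finset.sum_sub_distrib, ← Finset.sum_mul, hl]

/-- A variable Q is the same datum as a finite mixture of posteriors averaging to p. The first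
component of the hull records this barycentre, the second the averaged tension. -/
lemma setOf_tension_eq (p : stdSimplex ℝ (α × β)) :
    {t | ∃ (n : ℕ) (w : α × β → stdSimplex ℝ (Fin n)), t = tension p w} =
      {t | ((⇑p : α × β → ℝ), t) ∈
        convexHull ℝ (Set.range fun a : stdSimplex ℝ (α × β) => (⇑a, pointTension p a))} := by
  ext t
  constructor
  · rintro ⟨n, w, rfl⟩
    -- Bayes: after the swap, `l` is the law of Q and `a q` the posterior of the pair given Q = q.
    obtain ⟨a, ha⟩ := exists_extend_eq (stdSimplex.map Prod.swap (extend p w))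
    set l := stdSimplex.map Prod.fst (stdSimplex.map Prod.swap (extend p w))
    have hp : stdSimplex.map Prod.snd (extend l a) = p := by
      rw [ha, map_map]
      exact map_fst_extend p w
    have ht : tension p w = ∑ q, l q • pointTension p (a q) := by
      have := tensionOf_mixture l a
      rw [hp, ha, tensionOf_map] at this
      exact this
    refine mem_convexHull_of_exists_fintype l (fun q => (⇑(a q), pointTension p (a q)))
      (stdSimplex.zero_le l) (stdSimplex.sum_eq_one l) (fun q => ⟨a q, rfl⟩) ?_
    refine Prod.ext ?_ ?_
    · ext s
      have := map_snd_extend_apply l a s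
      rw [hp] at this
      simp [Prod.fst_sum, this]
    · simp [Prod.snd_sum, ht]
  · intro h
    obtain ⟨ι, _, w, z, hw, hw1, hz, hsum⟩ := mem_convexHull_iff_exists_fintype.1 h
    choose a ha using hz
    set l : stdSimplex ℝ ι := ⟨w, hw, hw1⟩
    have hl : ∀ q, l q = w q := fun _ => rfl
    have h1 := congrArg Prod.fst hsum
    have h2 := congrArg Prod.snd hsum
    simp only [Prod.fst_sum, Prod.snd_sum, ← ha, Prod.smul_fst, Prod.smul_snd] at h1 h2
    have hp : stdSimplex.map Prod.snd (extend l a) = p := by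
      ext s
      rw [map_snd_extend_apply, ← h1]
      simp [hl]
    obtain ⟨n, v, hv⟩ := exists_tension_eq (extend l a) (fun s => s.2.1) (fun s => s.2.2) Prod.fst
    refine ⟨n, v, ?_⟩
    have e : stdSimplex.map (fun s : ι × (α × β) => (s.2.1, s.2.2)) (extend l a) = p := hp
    rw [e, tensionOf_mixture, hp] at hv
    rw [← hv, ← h2]
    rfl

lemma continuous_entropyOf (X : Ω → α) : Continuous fun p : stdSimplex ℝ Ω => entropyOf p X := by
  have h : ∀ a : α, Continuous fun p : stdSimplex ℝ Ω => stdSimplex.map X p a := fun a =>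
    (continuous_apply a).comp (continuous_subtype_val.comp (stdSimplex.continuous_map X))
  unfold entropyOf entropy
  exact continuous_finsetSum _ fun a _ => (Real.continuous_negMulLog.comp (h a)).div_const _

lemma continuous_condEntropy (X : Ω → α) (Z : Ω → γ) :
    Continuous fun p : stdSimplex ℝ Ω => condEntropy p X Z :=
  (continuous_entropyOf _).sub (continuous_entropyOf _)

lemma isCompact_setOf_tension (p : stdSimplex ℝ (α × β)) :
    IsCompact {t | ∃ (n : ℕ) (w : α × β → stdSimplex ℝ (Fin n)), t = tension p w} := by
  rw [setOf_tension_eq]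
  have hG : Continuous fun a : stdSimplex ℝ (α × β) => (⇑a, pointTension p a) := by
    refine continuous_subtype_val.prodMk (continuous_pi fun i => ?_)
    fin_cases i
    · exact continuous_const.sub (continuous_condEntropy _ _)
    · exact continuous_const.sub (continuous_condEntropy _ _)
    · exact (continuous_condEntropy _ _).sub (continuous_condEntropy _ _)
  have hK := isCompact_convexHull (isCompact_range hG)
  -- The slice over p is closed as a preimage of the hull, and lies in its compact projection.
  refine (hK.image continuous_snd).of_isClosed_subset
    (hK.isClosed.preimage (Continuous.prodMk_right _)) fun t ht => ⟨_, ht, rfl⟩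

lemma convex_setOf_tension (p : stdSimplex ℝ (α × β)) :
    Convex ℝ {t | ∃ (n : ℕ) (w : α × β → stdSimplex ℝ (Fin n)), t = tension p w} := by
  rw [setOf_tension_eq]
  intro s hs t ht c d hc hd hcd
  have := convex_convexHull ℝ _ hs ht hc hd hcd
  rwa [Prod.smul_mk, Prod.smul_mk, Prod.mk_add_mk, Convex.combo_self hcd] at this

end mixture

/-! ### Increasing hulls of convex and compact sets -/

lemma convex_increasingHull {d : ℕ} {S : Set (Fin d → ℝ)} (hS : Convex ℝ S) :
    Convex ℝ (increasingHull S) := by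
  rintro s ⟨hs, s', hs', hle⟩ t ⟨ht, t', ht', hle'⟩ a b ha hb hab
  exact ⟨add_nonneg (smul_nonneg ha hs) (smul_nonneg hb ht), _, hS hs' ht' ha hb hab,
    add_le_add (smul_le_smul_of_nonneg_left hle ha) (smul_le_smul_of_nonneg_left hle' hb)⟩

lemma isClosed_increasingHull {d : ℕ} {S : Set (Fin d → ℝ)} (hS : IsCompact S) :
    IsClosed (increasingHull S) :=
  isClosed_Ici.inter (hS.isClosed.upperClosure_pi hS.isBounded.bddBelow)

/-! ### The region of tension is a robust monotone region -/

section tensionRegion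

variable {Ω α β γ α₁ β₁ α₂ β₂ : Type u} [Fintype Ω] [Fintype α] [Fintype β] [Fintype γ]
  [Fintype α₁] [Fintype β₁] [Fintype α₂] [Fintype β₂]

lemma tensionRegion_statSecure : IsStatSecureRobust tensionRegion.{u} 1 := by
  rintro Ω α μ ν β _ _ _ _ _ p X U V Y φ hφ hX hY _ ⟨s, hs, rfl⟩
  obtain ⟨n, w, hw⟩ := exists_of_mem_tensionRegion_on hs
  set r := extend p fun ω => w ((X ω, U ω), (Y ω, V ω))
  have hp : stdSimplex.map Prod.fst r = p := map_fst_extend _ _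
  rw [← hp, condMutualInfo_map] at hX hY
  rw [← hp, PairRegion.on_map]
  refine mem_tensionRegion_on Prod.snd ((tensionOf_secure_derivation Prod.snd hφ hX hY).trans ?_)
  intro i
  rw [one_mul]
  exact add_le_add_left (hw i) φ

lemma tensionRegion_local_left {p : stdSimplex ℝ Ω} {X : Ω → α} {Y : Ω → β} {Z : Ω → γ}
    (h : IsMarkovChain p X Y Z) :
    tensionRegion.{u}.on p Y Z ⊆ tensionRegion.{u}.on p (fun ω => (X ω, Y ω)) Z := by
  intro s hs
  obtain ⟨n, w, hw⟩ := exists_of_mem_tensionRegion_on hs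
  have hQ := condMutualInfo_extend p X (fun ω => (Y ω, Z ω)) w
  have h := h.condMutualInfo_eq_zero
  set r := extend p fun ω => w (Y ω, Z ω)
  have hp : stdSimplex.map Prod.fst r = p := map_fst_extend _ _
  rw [← hp, condMutualInfo_map] at h
  rw [← hp, PairRegion.on_map]
  exact mem_tensionRegion_on Prod.snd ((tensionOf_local_left h hQ).trans hw)

lemma tensionRegion_local_right {p : stdSimplex ℝ Ω} {X : Ω → α} {Y : Ω → β} {Z : Ω → γ}
    (h : IsMarkovChain p X Y Z) :
    tensionRegion.{u}.on p X Y ⊆ tensionRegion.{u}.on p X (fun ω => (Y ω, Z ω)) := by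
  intro s hs
  obtain ⟨n, w, hw⟩ := exists_of_mem_tensionRegion_on hs
  have hQ := condMutualInfo_extend p Z (fun ω => (X ω, Y ω)) w
  have h := h.condMutualInfo_eq_zero
  set r := extend p fun ω => w (X ω, Y ω)
  have hp : stdSimplex.map Prod.fst r = p := map_fst_extend _ _
  rw [← hp, condMutualInfo_map] at h
  rw [← hp, PairRegion.on_map]
  exact mem_tensionRegion_on Prod.snd ((tensionOf_local_right h hQ).trans hw)

lemma tensionRegion_communication_left (p : stdSimplex ℝ Ω) (X : Ω → α) (Y : Ω → β) (f : α → γ) :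
    tensionRegion.{u}.on p X Y ⊆ tensionRegion.{u}.on p X (fun ω => (Y ω, f (X ω))) := by
  intro s hs
  obtain ⟨n, w, hw⟩ := exists_of_mem_tensionRegion_on hs
  set r := extend p fun ω => w (X ω, Y ω)
  have hp : stdSimplex.map Prod.fst r = p := map_fst_extend _ _
  rw [← hp, PairRegion.on_map]
  exact mem_tensionRegion_on _ ((tensionOf_communication_left r _ _ Prod.snd f).trans hw)

lemma tensionRegion_communication_right (p : stdSimplex ℝ Ω) (X : Ω → α) (Y : Ω → β) (f : β → γ) :
    tensionRegion.{u}.on p X Y ⊆ tensionRegion.{u}.on p (fun ω => (X ω, f (Y ω))) Y := by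
  intro s hs
  obtain ⟨n, w, hw⟩ := exists_of_mem_tensionRegion_on hs
  set r := extend p fun ω => w (X ω, Y ω)
  have hp : stdSimplex.map Prod.fst r = p := map_fst_extend _ _
  rw [← hp, PairRegion.on_map]
  exact mem_tensionRegion_on _ ((tensionOf_communication_right r _ _ Prod.snd f).trans hw)

lemma Independent.of_map {Ω' α β : Type*} [Fintype Ω'] [Fintype α] [Fintype β]
    {p : stdSimplex ℝ Ω'} {f : Ω' → Ω} {A : Ω → α} {B : Ω → β}
    (h : Independent (stdSimplex.map f p) A B) :
    Independent p (fun ω => A (f ω)) (fun ω => B (f ω)) := by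
  simpa only [Independent, map_map] using h

variable {p : stdSimplex ℝ Ω} {X₁ : Ω → α₁} {Y₁ : Ω → β₁} {X₂ : Ω → α₂} {Y₂ : Ω → β₂}

lemma add_mem_tensionRegion_on
    (h : Independent p (fun ω => (X₁ ω, Y₁ ω)) (fun ω => (X₂ ω, Y₂ ω)))
    {a b : Fin 3 → ℝ} (ha : a ∈ tensionRegion.{u}.on p X₁ Y₁)
    (hb : b ∈ tensionRegion.{u}.on p X₂ Y₂) :
    a + b ∈ tensionRegion.{u}.on p (fun ω => (X₁ ω, X₂ ω)) (fun ω => (Y₁ ω, Y₂ ω)) := by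
  obtain ⟨n, w, hw⟩ := exists_of_mem_tensionRegion_on ha
  have hQ := condMutualInfo_extend p (fun ω => (X₂ ω, Y₂ ω)) (fun ω => (X₁ ω, Y₁ ω)) w
  set r := extend p fun ω => w (X₁ ω, Y₁ ω)
  have hr : stdSimplex.map Prod.fst r = p := map_fst_extend _ _
  rw [← hr, PairRegion.on_map] at hb
  obtain ⟨m, v, hv⟩ := exists_of_mem_tensionRegion_on hb
  have hQ' := condMutualInfo_extend r (fun t => (X₁ t.1, Y₁ t.1, t.2))
    (fun t => (X₂ t.1, Y₂ t.1)) v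
  -- Q₂ is drawn after Q₁ but from the second pair alone, which supplies the Markov condition `hQ'`.
  set r' := extend r fun t => v (X₂ t.1, Y₂ t.1)
  have hr' : stdSimplex.map Prod.fst r' = r := map_fst_extend _ _
  rw [← hr', condMutualInfo_map] at hQ
  rw [← hr', tensionOf_map] at hw
  rw [← hr, ← hr'] at h ⊢
  rw [PairRegion.on_map, PairRegion.on_map]
  exact mem_tensionRegion_on _
    ((tensionOf_prod_le h.of_map.of_map hQ hQ').trans (add_le_add hw hv))

lemma exists_add_of_mem_tensionRegion_on
    (h : Independent p (fun ω => (X₁ ω, Y₁ ω)) (fun ω => (X₂ ω, Y₂ ω))) {s : Fin 3 → ℝ}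
    (hs : s ∈ tensionRegion.{u}.on p (fun ω => (X₁ ω, X₂ ω)) (fun ω => (Y₁ ω, Y₂ ω))) :
    ∃ a ∈ tensionRegion.{u}.on p X₁ Y₁, ∃ b ∈ tensionRegion.{u}.on p X₂ Y₂, s = a + b := by
  obtain ⟨n, w, hw⟩ := exists_of_mem_tensionRegion_on hs
  set r := extend p fun ω => w ((X₁ ω, X₂ ω), (Y₁ ω, Y₂ ω))
  have hr : stdSimplex.map Prod.fst r = p := map_fst_extend _ _
  rw [← hr] at h
  have hle := (tensionOf_add_le Prod.snd h.of_map).trans hw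
  rw [← hr, PairRegion.on_map, PairRegion.on_map]
  -- The first summand is exactly the tension of the first pair; all the slack goes to the second.
  exact ⟨_, mem_tensionRegion_on Prod.snd le_rfl, s - tensionOf r _ _ Prod.snd,
    mem_tensionRegion_on _ (le_sub_iff_add_le'.2 hle), (add_sub_cancel _ _).symm⟩

end tensionRegion

lemma tensionRegion_subset_translate {α β : Type u} [Fintype α] [Fintype β]
    (p q : stdSimplex ℝ (α × β)) :
    tensionRegion.{u} p ⊆ translate (tensionRegion.{u} q)
      (-(tensionModulus (tvDist p q) * Real.logb 2 (Fintype.card α * Fintype.card β))) := by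
  rintro s ⟨-, _, ⟨n, w, rfl⟩, h⟩
  have hle : tension q w ≤ fun i => s i + tensionModulus (tvDist p q) *
      Real.logb 2 (Fintype.card α * Fintype.card β) := fun i => by
    have := tension_le_add_tvDist q p w i
    rw [tvDist_comm] at this
    exact this.trans (add_le_add_left (h i) _)
  refine ⟨_, ⟨?_, _, ⟨n, w, rfl⟩, hle⟩, ?_⟩
  · exact (tensionOf_nonneg _ _ _ _).trans hle
  · ext i
    simp

lemma tensionRegion_isMonotoneRegion : IsMonotoneRegion tensionRegion.{u} where
  nonneg _ _ hr := hr.1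
  upward_closed _ _ _ hle := fun ⟨h0, t, ht, h⟩ => ⟨h0.trans hle, t, ht, h.trans hle⟩
  local_computation _ _ _ _ h := ⟨tensionRegion_local_left h, tensionRegion_local_right h⟩
  communication_left := tensionRegion_communication_left
  communication_right := tensionRegion_communication_right
  secure_derivation p X U V Y hX hY := by
    intro s hs
    have hY := hY.condMutualInfo_eq_zero
    refine tensionRegion_statSecure p X U V Y 0 le_rfl hX.condMutualInfo_eq_zero.le hY.le
      ⟨s, hs, ?_⟩
    simp
  additive p X₁ Y₁ X₂ Y₂ h := by
    ext s
    constructor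
    · exact exists_add_of_mem_tensionRegion_on h
    · rintro ⟨a, ha, b, hb, rfl⟩
      exact add_mem_tensionRegion_on h ha hb

lemma tensionRegion_isRobustMonotoneRegion : IsRobustMonotoneRegion tensionRegion.{u} where
  toIsMonotoneRegion := tensionRegion_isMonotoneRegion
  stat_secure_derivation := ⟨1, zero_le_one, tensionRegion_statSecure⟩
  continuity := by
    have hc : Continuous fun ε : unitInterval => (tensionModulus ε).toNNReal :=
      continuous_real_toNNReal.comp (continuous_tensionModulus.comp continuous_subtype_val)
    refine ⟨_, hc, (isCompact_range hc).bddAbove, ?_, fun p q ε hε => ?_⟩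
    · simp [tensionModulus]
    · rw [Real.coe_toNNReal _ (tensionModulus_nonneg ε.2.1), ← hε]
      exact tensionRegion_subset_translate p q
  convex p := convex_increasingHull (convex_setOf_tension p)
  closed p := isClosed_increasingHull (isCompact_setOf_tension p)

end

end Tension

theorem mainTheorem4 :
    Tension.IsRobustMonotoneRegion Tension.tensionRegion.{u} ∧
      Tension.IsStatSecureRobust Tension.tensionRegion.{u} 1 :=
  ⟨Tension.tensionRegion_isRobustMonotoneRegion, Tension.tensionRegion_statSecure⟩
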